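/- Let $\Delta$ be the category of finite non-empty ordinals $\Delta^n=\{0<\dots<n\}$, and let $\mathcal A\subset\prod_{n\ge 1}\Delta$ be the full subcategory on the sequences $A=(A_1,A_2,\dots)$ with only finitely many components different from $\Delta^0$. For a morphism $f$ in $\mathcal A$ let $\deg f$ be the smallest $k\ge 1$ such that $f_k$ is constant (factors through $\Delta^0$), and for parallel $f,g$ put $f\sim g$ if and only if $\deg f=\deg g=:d$ and $f_k=g_k$ for $1\le k\le d$. This is a congruence, and $\deg$ and the components $f_1,\dots,f_{\deg f}$ are well defined on $\mathcal A/{\sim}$. For $A\in\mathcal A$ let $\dim A$ be the smallest $d\ge 0$ with $A_{d+1}=\Delta^0$. Let $\Theta\subset\mathcal A/{\sim}$ be the full subcategory on the objects $A$ with $A_n=\Delta^0$ for all $n>\dim A$ (the generalized simplices); identify $A\in\Theta$ with the presheaf of sets on $\Theta$ that it represents. A face of $A\in\Theta$ is a maximal proper subobject of $A$ in $\Theta$ (or the image of the corresponding monomorphism of presheaves). It is inner if for some $k\in\{1,\dots,\dim A\}$ its $k$-th component is an inner face in $\Delta$, that is, a monomorphism into $A_k=\Delta^{a}$ whose image omits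 exactly one vertex $m$, with $0<m<a$; otherwise it is outer. Let $\mathfrak F_A^o$ be the set of outer faces of $A$. An inner horn of $A$ is the union of all faces of $A$ except one inner face. A morphism of presheaves on $\Theta$ is an inner fibration if it has the right lifting property with respect to the inclusion $\Lambda\subset A$ of every inner horn $\Lambda$ of every $A\in\Theta$; it is inner anodyne if it has the left lifting property with respect to every inner fibration. The spine $I(A)\subset A$ consists of the morphisms $s\colon B\to A$ in $\Theta$ such that for all $k\in\{1,\dots,\deg s\}$ the component $s_k\colon B_k\to A_k$ lies in the classical spine of $A_k$, i.e. its image is contained in $\{i,i+1\}$ for some $i$. **Proposition.** Assume that for every $A\in\Theta$ the inclusion $I(A)\subset I(A)\cup\bigcup\mathfrak F_A^o$ is inner anodyne. Then for every $A\in\Theta$ the spine inclusion $I(A)\subset A$ is inner anodyne. -/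

import Mathlib

open CategoryTheory

noncomputable section

namespace GenSimplex

/-! Components of an object or a morphism are indexed by `ℕ` starting from `0`: component `i` here
is the component with positive index `i + 1` in the usual numbering `A = (A₁, A₂, …)`. -/

/-- A map of classical simplices is constant if it factors through `Δ⁰`. -/
def IsConst {m n : SimplexCategory} (f : m ⟶ n) : Prop :=
  ∃ (p : m ⟶ SimplexCategory.mk 0) (x : SimplexCategory.mk 0 ⟶ n), f = p ≫ x

theorem IsConst.comp_left {l m n : SimplexCategory} (f : l ⟶ m) {g : m ⟶ n} (h : IsConst g) :
    IsConst (f ≫ g) := by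
  obtain ⟨p, x, rfl⟩ := h
  exact ⟨f ≫ p, x, by simp⟩

theorem IsConst.comp_right {l m n : SimplexCategory} {f : l ⟶ m} (h : IsConst f) (g : m ⟶ n) :
    IsConst (f ≫ g) := by
  obtain ⟨p, x, rfl⟩ := h
  exact ⟨p, x ≫ g, by simp⟩

theorem isConst_of_source {m n : SimplexCategory} (f : m ⟶ n) (h : m = SimplexCategory.mk 0) :
    IsConst f := by
  subst h
  exact ⟨𝟙 _, f, by simp⟩

/-- Sequences of classical simplices with only finitely many components different from `Δ⁰`. -/
def finProdProp : ObjectProperty (ℕ → SimplexCategory) :=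
  fun A => {n | A n ≠ SimplexCategory.mk 0}.Finite

/-- The restricted product `∏' Δ`: the full subcategory of the countable product of copies of `Δ`
on the sequences with only finitely many components different from `Δ⁰`. -/
abbrev FinProd : Type := finProdProp.FullSubcategory

theorem FinProd.exists_trivial (A : FinProd) : ∃ d : ℕ, A.obj d = SimplexCategory.mk 0 := by
  obtain ⟨d, hd⟩ := A.property.exists_notMem
  exact ⟨d, not_not.mp hd⟩

theorem FinProd.exists_const {A B : FinProd} (f : A ⟶ B) : ∃ k : ℕ, IsConst (f.hom k) := by
  obtain ⟨d, hd⟩ := A.exists_trivial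
  exact ⟨d, isConst_of_source _ hd⟩

open Classical in
/-- The dimension: the smallest `d ∈ {0, 1, …}` with `A_{d+1} = Δ⁰` (in the usual numbering). -/
def dim (A : FinProd) : ℕ := Nat.find A.exists_trivial

open Classical in
/-- The index (starting from `0`) of the first constant component of `f`;
this is `deg f - 1`, where `deg f` is the smallest `k ∈ {1, 2, …}` such that `f_k` is constant. -/
def deg {A B : FinProd} (f : A ⟶ B) : ℕ := Nat.find (FinProd.exists_const f)

theorem deg_const {A B : FinProd} (f : A ⟶ B) : IsConst (f.hom (deg f)) := by
  classical exact Nat.find_spec (FinProd.exists_const f)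

theorem deg_le {A B : FinProd} (f : A ⟶ B) {k : ℕ} (h : IsConst (f.hom k)) : deg f ≤ k := by
  classical exact Nat.find_min' (FinProd.exists_const f) h

/-- `f ∼ g` iff `f` and `g` have the same degree and agree in all components up to and
including that degree. -/
def rel : HomRel FinProd :=
  fun _ _ f g => deg f = deg g ∧ ∀ k ≤ deg f, f.hom k = g.hom k

theorem deg_comp_le_left {A B C : FinProd} (f : A ⟶ B) (g : B ⟶ C) : deg (f ≫ g) ≤ deg f :=
  deg_le _ ((deg_const f).comp_right _)

theorem deg_comp_le_right {A B C : FinProd} (f : A ⟶ B) (g : B ⟶ C) : deg (f ≫ g) ≤ deg g :=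
  deg_le _ ((deg_const g).comp_left _)

theorem rel_of_agree {A B : FinProd} {f g : A ⟶ B} (h : ∀ k ≤ deg f, f.hom k = g.hom k) :
    rel f g := by
  refine ⟨le_antisymm ?_ ?_, h⟩
  · by_contra hlt
    have hlt' : deg g < deg f := not_le.mp hlt
    refine hlt (deg_le f ?_)
    rw [h _ hlt'.le]
    exact deg_const g
  · apply deg_le
    rw [← h _ le_rfl]
    exact deg_const f

instance : Congruence rel where
  comp_left f g _ h := rel_of_agree fun k hk =>
    congrArg (fun t => f.hom k ≫ t) (h.2 k (hk.trans (deg_comp_le_right f g)))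
  comp_right g h := rel_of_agree fun k hk =>
    congrArg (fun t => t ≫ g.hom k) (h.2 k (hk.trans (deg_comp_le_left _ g)))
  equivalence :=
    { refl := fun _ => ⟨rfl, fun _ _ => rfl⟩
      symm := fun h => ⟨h.1.symm, fun k hk => (h.2 k (h.1 ▸ hk)).symm⟩
      trans := fun h h' => ⟨h.1.trans h'.1, fun k hk =>
        (h.2 k hk).trans (h'.2 k (h.1 ▸ hk))⟩ }

/-- The objects `A` with `A_n = Δ⁰` for all `n > dim A` (in the usual numbering). -/
def thetaProp : ObjectProperty (Quotient rel) :=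
  fun A => ∀ n, dim A.as ≤ n → A.as.obj n = SimplexCategory.mk 0

/-- The category of generalized simplices: the full subcategory of `FinProd / ∼` on the objects
`A` with `A_n = Δ⁰` for all `n > dim A`. -/
abbrev Theta : Type := thetaProp.FullSubcategory

/-- The underlying sequence of classical simplices of a generalized simplex. -/
abbrev Theta.seq (A : Theta) : FinProd := A.obj.as

/-- `f` is a sequence of maps representing the morphism `s` of generalized simplices. -/
def Represents {A B : Theta} (f : A.seq ⟶ B.seq) (s : A ⟶ B) : Prop :=
  (Quotient.functor rel).map f = s.hom

theorem exists_represents {A B : Theta} (s : A ⟶ B) :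
    ∃ f : A.seq ⟶ B.seq, Represents f s := by
  obtain ⟨f, hf⟩ := (Quotient.functor rel).map_surjective (X := A.seq) (Y := B.seq) s.hom
  exact ⟨f, hf⟩

theorem Represents.rel {A B : Theta} {f g : A.seq ⟶ B.seq} {s : A ⟶ B}
    (hf : Represents f s) (hg : Represents g s) : rel f g :=
  (Quotient.functor_map_eq_iff _ f g).mp (hf.trans hg.symm)

theorem Represents.comp {A B C : Theta} {f : A.seq ⟶ B.seq} {g : B.seq ⟶ C.seq}
    {s : A ⟶ B} {t : B ⟶ C} (hf : Represents f s) (hg : Represents g t) :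
    Represents (f ≫ g) (s ≫ t) := by
  unfold Represents at *
  rw [Functor.map_comp, hf, hg]
  rfl

/-- Set-valued presheaves on the category of generalized simplices. -/
abbrev PSh : Type 1 := Thetaᵒᵖ ⥤ Type

/-- The faces of `A`: the maximal proper subobjects of `A`. -/
def IsFace {A : Theta} (F : Subobject A) : Prop := IsCoatom F

/-- The map of classical simplices `f` is an inner face of `Δⁿ`: a monomorphism whose image omits
exactly one vertex `i`, where `0 < i < n`. -/
def IsClassicalInnerFace {m n : SimplexCategory} (f : m ⟶ n) : Prop :=
  Mono f ∧ ∃ i : Fin (n.len + 1), i ≠ 0 ∧ i ≠ Fin.last n.len ∧ Set.range f.toOrderHom = {i}ᶜ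

/-- A face of `A` is inner if one of its (well-defined) components with index in
`{1, …, dim A}` (in the usual numbering) is a classical inner face. -/
def IsInnerFace {A : Theta} (F : Subobject A) : Prop :=
  IsFace F ∧ ∃ f : (F : Theta).seq ⟶ A.seq, Represents f F.arrow ∧
    ∃ k < dim A.seq, k ≤ deg f ∧ IsClassicalInnerFace (f.hom k)

/-- A face of `A` is outer if it is not inner. -/
def IsOuterFace {A : Theta} (F : Subobject A) : Prop := IsFace F ∧ ¬ IsInnerFace F

/-- The subpresheaf of the representable presheaf `A` given by a subobject of `A`. -/
def image {A : Theta} (F : Subobject A) : Subfunctor (yoneda.obj A) :=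
  Subfunctor.range (yoneda.map F.arrow)

/-- The horn of `A` with missing face `B`: the union of all faces of `A` except `B`. -/
def horn {A : Theta} (B : Subobject A) : Subfunctor (yoneda.obj A) :=
  ⨆ (F : Subobject A) (_ : IsFace F ∧ F ≠ B), image F

/-- The inner horn inclusions `Λ ⊂ A`. -/
inductive innerHornInclusions : MorphismProperty PSh
  | mk {A : Theta} (B : Subobject A) (hB : IsInnerFace B) : innerHornInclusions (horn B).ι

/-- Inner fibrations: right lifting property with respect to every inner horn inclusion. -/
def innerFibrations : MorphismProperty PSh := innerHornInclusions.rlp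

/-- Inner anodyne maps: left lifting property with respect to every inner fibration. -/
def innerAnodyne : MorphismProperty PSh := innerFibrations.llp

/-- The simplex `f` of `Δⁿ` lies in the classical spine of `Δⁿ`, i.e. in the union of the edges
`{i, i + 1}` (the whole of `Δ⁰` if `n = 0`). -/
def InClassicalSpine {m n : SimplexCategory} (f : m ⟶ n) : Prop :=
  ∃ i : ℕ, ∀ x, (f.toOrderHom x : ℕ) = i ∨ (f.toOrderHom x : ℕ) = i + 1

/-- The simplex `s : B ⟶ A` lies in the spine of `A`: all components of `s` up to and including
its degree lie in the classical spines of the components of `A`. -/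
def InSpine {A B : Theta} (s : B ⟶ A) : Prop :=
  ∃ f : B.seq ⟶ A.seq, Represents f s ∧ ∀ k ≤ deg f, InClassicalSpine (f.hom k)

/-- Membership in the spine does not depend on the representative. -/
theorem inSpine_iff {A B : Theta} {s : B ⟶ A} {f : B.seq ⟶ A.seq} (hf : Represents f s) :
    InSpine s ↔ ∀ k ≤ deg f, InClassicalSpine (f.hom k) := by
  refine ⟨?_, fun h => ⟨f, hf, h⟩⟩
  rintro ⟨g, hg, h⟩ k hk
  have hr := hf.rel hg
  rw [hr.2 k hk]
  exact h k (hr.1 ▸ hk)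

theorem InSpine.precomp {A B C : Theta} {s : B ⟶ A} (hs : InSpine s) (t : C ⟶ B) :
    InSpine (t ≫ s) := by
  obtain ⟨f, hf, h⟩ := hs
  obtain ⟨g, hg⟩ := exists_represents t
  refine ⟨g ≫ f, hg.comp hf, fun k hk => ?_⟩
  obtain ⟨i, hi⟩ := h k (hk.trans (deg_comp_le_right g f))
  exact ⟨i, fun x => hi ((g.hom k).toOrderHom x)⟩

/-- The spine `I(A) ⊂ A`. -/
def spine (A : Theta) : Subfunctor (yoneda.obj A) where
  obj B := {s | InSpine (B := B.unop) s}
  map t _ hs := InSpine.precomp hs t.unop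

/-- The union of all outer faces of `A`. -/
def outerFaces (A : Theta) : Subfunctor (yoneda.obj A) :=
  ⨆ (F : Subobject A) (_ : IsOuterFace F), image F

end GenSimplex

end

/-! If every component of `A` below `dim A` has length less than 2, the spine is all of `A` and the
inclusion is an isomorphism. Otherwise fix a component of length at least 2. A spine simplex cannot
reach both its first and its last vertex, so it lies in an outer face. Hence the spine is contained
in the union of the outer faces, the hypothesis makes the inclusion into that union inner anodyne,
and it remains to treat the inclusion of the outer faces into `A`.

Faces are controlled by vertices: up to the degeneracy handled in `exists_hasFace_mem_omitting`,
they are the subpresheaves `omitting A v`. So the union of the outer faces is the generalized horn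
`hornOf A S`, with `S` the nonempty set of inner vertices. `innerAnodyne_hornOf` proves that such
inclusions are inner anodyne by induction on `S.card`: gluing in the missing face opposite to some
`v ∈ S` is a pushout of a generalized inner horn of that face with one missing vertex fewer. -/

namespace CategoryTheory.Subfunctor

open Limits

universe w v u

/-! ### Pushouts of subpresheaves -/

/-- Gluing the source of a monomorphism `p` to a subfunctor `G` along the preimage of `G` yields
the union of `G` and the range of `p`. -/
theorem isPushout_preimage {C : Type u} [Category.{v} C] {F F' : C ⥤ Type w} (p : F' ⟶ F)
    (hp : ∀ U, Function.Injective (p.app U)) {G G' : Subfunctor F} (hG : G ≤ G')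
    (hr : range p ≤ G') (h : G' ≤ G ⊔ range p) :
    IsPushout (G.preimage p).ι (G.fromPreimage p) (lift p hr) (homOfLe hG) where
  w := rfl
  -- Colimits of presheaves are pointwise, and in sets a pullback square of injections whose legs
  -- jointly cover the target is a pushout.
  isColimit' :=
    ⟨evaluationJointlyReflectsColimits _ fun U ↦
      (PushoutCocone.isColimitMapCoconeEquiv _ _).2 (by
        have : Mono ((lift p hr).app U) := (mono_iff_injective _).mpr fun x y hxy =>
          hp U (congrArg Subtype.val hxy)
        have key : IsPushout ((G.preimage p).ι.app U) ((G.fromPreimage p).app U)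
            ((lift p hr).app U) ((homOfLe hG).app U) := by
          refine Types.isPushout_of_isPullback_of_mono' ?_ ?_ ?_
          · rw [Types.isPullback_iff]
            refine ⟨rfl, fun x y hxy => Subtype.ext hxy.1, fun x y hxy => ?_⟩
            have hx : p.app U x = y.1 := congrArg Subtype.val hxy
            exact ⟨⟨x, by change p.app U x ∈ G.obj U; rw [hx]; exact y.2⟩, rfl, Subtype.ext hx⟩
          · refine Set.eq_univ_iff_forall.mpr ?_
            rintro ⟨y, hy⟩
            rcases h U hy with hy' | ⟨x, rfl⟩
            · exact Or.inr ⟨⟨y, hy'⟩, rfl⟩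
            · exact Or.inl ⟨x, rfl⟩
          · intro x y _ _ hxy
            have hval : x.1 = y.1 := congrArg (Subtype.val (p := (· ∈ G'.obj U))) hxy
            exact Subtype.ext hval
        exact key.isColimit)⟩

end CategoryTheory.Subfunctor

noncomputable section

namespace GenSimplex

/-! ### Constancy, degree, dimension and representatives -/

theorem isConst_iff {m n : SimplexCategory} (f : m ⟶ n) :
    IsConst f ↔ ∀ x y, f.toOrderHom x = f.toOrderHom y := by
  constructor
  · rintro ⟨p, x, rfl⟩ a b
    exact congrArg x.toOrderHom (Subsingleton.elim (α := Fin 1) (p.toOrderHom a) (p.toOrderHom b))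
  · intro h
    refine ⟨SimplexCategory.Hom.mk ⟨fun _ => 0, fun _ _ _ => le_rfl⟩,
      SimplexCategory.Hom.mk ⟨fun _ => f.toOrderHom 0, fun _ _ _ => le_rfl⟩, ?_⟩
    ext x : 3
    exact h x 0

theorem len_eq_zero_iff {n : SimplexCategory} : n.len = 0 ↔ n = SimplexCategory.mk 0 :=
  ⟨fun h => SimplexCategory.ext h, fun h => h ▸ rfl⟩

theorem injective_of_mono {m n : SimplexCategory} (f : m ⟶ n) [Mono f] :
    Function.Injective f.toOrderHom :=
  SimplexCategory.mono_iff_injective.mp inferInstance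

/-- Every vertex of a nontrivial classical simplex has an opposite face. -/
theorem exists_mono_range_compl (n : SimplexCategory) (hn : n.len ≠ 0) (v : Fin (n.len + 1)) :
    ∃ (m : SimplexCategory) (f : m ⟶ n), Mono f ∧ ∀ p, (∃ x, f.toOrderHom x = p) ↔ p ≠ v := by
  obtain ⟨k, rfl⟩ : ∃ k, n = SimplexCategory.mk (k + 1) :=
    ⟨n.len - 1, SimplexCategory.ext (Nat.succ_pred_eq_of_ne_zero hn).symm⟩
  refine ⟨SimplexCategory.mk k, SimplexCategory.δ v, inferInstance, fun p => ?_⟩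
  exact Fin.exists_succAbove_eq_iff

theorem le_deg_iff {A B : FinProd} (f : A ⟶ B) (k : ℕ) :
    k ≤ deg f ↔ ∀ i < k, ¬ IsConst (f.hom i) := by
  classical exact Nat.le_find_iff _ _

theorem le_dim_iff (A : FinProd) (k : ℕ) :
    k ≤ dim A ↔ ∀ i < k, (A.obj i).len ≠ 0 := by
  classical
  simp only [Ne, len_eq_zero_iff]
  exact Nat.le_find_iff _ _

theorem len_ne_zero {A : FinProd} {i : ℕ} (h : i < dim A) : (A.obj i).len ≠ 0 :=
  (le_dim_iff A _).mp le_rfl i h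

theorem obj_dim (A : FinProd) : A.obj (dim A) = SimplexCategory.mk 0 := by
  classical exact Nat.find_spec A.exists_trivial

theorem Theta.len_eq_zero (A : Theta) {i : ℕ} (h : dim A.seq ≤ i) : (A.seq.obj i).len = 0 :=
  len_eq_zero_iff.mpr (A.property i h)

theorem deg_comp_of_mono {A B C : FinProd} (g : A ⟶ B) (f : B ⟶ C) (hf : ∀ i, Mono (f.hom i)) :
    deg (g ≫ f) = deg g := by
  refine le_antisymm (deg_comp_le_left g f) (deg_le g ?_)
  have hc := (isConst_iff _).mp (deg_const (g ≫ f))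
  have := hf (deg (g ≫ f))
  exact (isConst_iff _).mpr fun x y => injective_of_mono (f.hom (deg (g ≫ f))) (hc x y)

/-- The morphism of generalized simplices represented by a sequence of maps. -/
def Theta.ofSeq {A B : Theta} (f : A.seq ⟶ B.seq) : A ⟶ B :=
  ObjectProperty.homMk ((Quotient.functor rel).map f)

theorem represents_ofSeq {A B : Theta} (f : A.seq ⟶ B.seq) : Represents f (Theta.ofSeq f) := rfl

theorem represents_id (A : Theta) : Represents (𝟙 A.seq) (𝟙 A) :=
  (Quotient.functor rel).map_id _

theorem Represents.eq_of_rel {A B : Theta} {f g : A.seq ⟶ B.seq} {s t : A ⟶ B}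
    (hf : Represents f s) (hg : Represents g t) (h : GenSimplex.rel f g) : s = t :=
  ObjectProperty.hom_ext _ (hf.symm.trans (((Quotient.functor_map_eq_iff _ f g).mpr h).trans hg))

/-- Composing with componentwise monomorphisms does not lower the degree, so no component relevant
for the factors is lost in the composites. -/
theorem mono_ofSeq {A B : Theta} (f : A.seq ⟶ B.seq) (hf : ∀ i, Mono (f.hom i)) :
    Mono (Theta.ofSeq f) where
  right_cancellation {C} s t hst := by
    obtain ⟨g, hg⟩ := exists_represents s
    obtain ⟨h, hh⟩ := exists_represents t
    have hr : rel (g ≫ f) (h ≫ f) := by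
      refine (hg.comp (represents_ofSeq f)).rel ?_
      rw [hst]
      exact hh.comp (represents_ofSeq f)
    refine hg.eq_of_rel hh (rel_of_agree fun k hk => ?_)
    have := hf k
    exact (cancel_mono (f.hom k)).mp (hr.2 k (hk.trans (deg_comp_of_mono g f hf).ge))

/-! ### Omitted vertices and opposite faces -/

/-- The vertices of the components of `A`. -/
abbrev Vertex (A : FinProd) : Type := Σ j : ℕ, Fin ((A.obj j).len + 1)

/-- The component of `f` containing the vertex `v` in its target is not well-defined modulo `∼`, or
it does not hit `v`. -/
def Omits {A B : FinProd} (f : B ⟶ A) (v : Vertex A) : Prop :=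
  v.1 ≤ deg f → ∀ x, (f.hom v.1).toOrderHom x ≠ v.2

theorem Omits.of_rel {A B : FinProd} {f g : B ⟶ A} {v : Vertex A} (hf : Omits f v)
    (h : rel f g) : Omits g v := fun hv => by
  have hv' : v.1 ≤ deg f := hv.trans h.1.ge
  rw [← h.2 _ hv']
  exact hf hv'

theorem Omits.precomp {A B C : FinProd} {f : B ⟶ A} {v : Vertex A} (hf : Omits f v)
    (g : C ⟶ B) : Omits (g ≫ f) v := fun hv x =>
  hf (hv.trans (deg_comp_le_right g f)) ((g.hom v.1).toOrderHom x)

/-- The simplices of `A` which omit the vertex `v`. -/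
def omitting (A : Theta) (v : Vertex A.seq) : Subfunctor (yoneda.obj A) where
  obj B := {s | ∃ f : B.unop.seq ⟶ A.seq, Represents f s ∧ Omits f v}
  map t s hs := by
    obtain ⟨f, hf, h⟩ := hs
    obtain ⟨g, hg⟩ := exists_represents t.unop
    exact ⟨g ≫ f, hg.comp hf, h.precomp g⟩

theorem mem_omitting {A B : Theta} {v : Vertex A.seq} {s : B ⟶ A} {f : B.seq ⟶ A.seq}
    (hf : Represents f s) : s ∈ (omitting A v).obj (Opposite.op B) ↔ Omits f v :=
  ⟨fun ⟨_, hg, h⟩ => h.of_rel (hg.rel hf), fun h => ⟨f, hf, h⟩⟩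

/-- The union of the subpresheaves of `A` omitting a vertex not in `S`. -/
def hornOf (A : Theta) (S : Finset (Vertex A.seq)) : Subfunctor (yoneda.obj A) :=
  ⨆ (v : Vertex A.seq) (_ : v.1 < dim A.seq ∧ v ∉ S), omitting A v

theorem mem_hornOf {A B : Theta} {S : Finset (Vertex A.seq)} {s : B ⟶ A} :
    s ∈ (hornOf A S).obj (Opposite.op B) ↔
      ∃ v : Vertex A.seq, (v.1 < dim A.seq ∧ v ∉ S) ∧
        s ∈ (omitting A v).obj (Opposite.op B) := by
  simp [hornOf]

/-- A vertex of `A` which has an opposite face. -/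
def Vertex.HasFace {A : FinProd} (v : Vertex A) : Prop :=
  v.1 < dim A ∧ (2 ≤ (A.obj v.1).len ∨ v.1 + 1 = dim A)

/-- The face of `A` opposite to the vertex `v`. -/
structure OppositeFace (A : Theta) (v : Vertex A.seq) where
  /-- the generalized simplex underlying the face -/
  obj : Theta
  /-- the components of the inclusion of the face -/
  seqHom : obj.seq ⟶ A.seq
  mono : ∀ i, Mono (seqHom.hom i)
  range_iff : ∀ i p, (∃ x, (seqHom.hom i).toOrderHom x = p) ↔ (⟨i, p⟩ : Vertex A.seq) ≠ v

theorem len_ne_zero_of_exists_ne {m n : SimplexCategory} (f : m ⟶ n) {p q : Fin (n.len + 1)}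
    (hp : ∃ x, f.toOrderHom x = p) (hq : ∃ x, f.toOrderHom x = q) (h : p ≠ q) : m.len ≠ 0 := by
  intro hm
  obtain rfl := len_eq_zero_iff.mp hm
  obtain ⟨x, rfl⟩ := hp
  obtain ⟨y, rfl⟩ := hq
  exact h (congrArg _ (Subsingleton.elim (α := Fin 1) x y))

/-- If a component does not contain `v`, or has at least three vertices, then two of its vertices
are different from `v`. -/
theorem Vertex.exists_pair_ne {A : FinProd} (v : Vertex A) {i : ℕ} (hi : (A.obj i).len ≠ 0)
    (h : i ≠ v.1 ∨ 2 ≤ (A.obj v.1).len) :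
    ∃ p q : Fin ((A.obj i).len + 1), p ≠ q ∧ (⟨i, p⟩ : Vertex A) ≠ v ∧ (⟨i, q⟩ : Vertex A) ≠ v := by
  obtain ⟨j, w⟩ := v
  by_cases hij : i = j
  · subst hij
    have h2 : 2 ≤ (A.obj i).len := by simpa using h
    have hcard : 1 < (Finset.univ.erase w).card := by simp; omega
    obtain ⟨p, hp, q, hq, hpq⟩ := Finset.one_lt_card.mp hcard
    exact ⟨p, q, hpq, by simpa using hp, by simpa using hq⟩
  · refine ⟨0, Fin.last _, fun h0 => hi ?_, fun h => hij (congrArg Sigma.fst h),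
      fun h => hij (congrArg Sigma.fst h)⟩
    simpa using (congrArg Fin.val h0).symm

theorem Vertex.HasFace.nonempty_oppositeFace {A : Theta} {v : Vertex A.seq} (hv : v.HasFace) :
    Nonempty (OppositeFace A v) := by
  have H : ∀ i, ∃ (X : SimplexCategory) (f : X ⟶ A.seq.obj i), Mono f ∧
      ∀ p, (∃ x, f.toOrderHom x = p) ↔ (⟨i, p⟩ : Vertex A.seq) ≠ v := by
    intro i
    obtain ⟨j, w⟩ := v
    by_cases hij : i = j
    · subst hij
      simpa using exists_mono_range_compl _ (len_ne_zero hv.1) w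
    · refine ⟨_, 𝟙 _, inferInstance, fun p => ⟨fun _ h => hij (congrArg Sigma.fst h), fun _ =>
        ⟨p, rfl⟩⟩⟩
  choose X f hf hr using H
  have hX : ∀ i, dim A.seq ≤ i → X i = SimplexCategory.mk 0 := fun i hi =>
    len_eq_zero_iff.mp (Nat.le_zero.mp
      (have := hf i; (SimplexCategory.len_le_of_mono (f i)).trans (A.len_eq_zero hi).le))
  let B : FinProd := ⟨X, (Set.finite_lt_nat (dim A.seq)).subset fun i hi =>
    not_le.mp fun h => hi (hX i h)⟩
  have hne : ∀ i < dim A.seq, (i ≠ v.1 ∨ 2 ≤ (A.seq.obj v.1).len) → (X i).len ≠ 0 := by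
    intro i hi h
    obtain ⟨p, q, hpq, hp, hq⟩ := v.exists_pair_ne (len_ne_zero hi) h
    exact len_ne_zero_of_exists_ne (f i) ((hr i p).mpr hp) ((hr i q).mpr hq) hpq
  have hB : thetaProp ⟨B⟩ := by
    intro n hn
    change dim B ≤ n at hn
    change X n = _
    by_cases hnA : dim A.seq ≤ n
    · exact hX n hnA
    -- Only a vertex in the last nontrivial component may have its component collapse to `Δ⁰`; in an
    -- earlier one this would leave nontrivial components beyond `dim B`.
    · rcases hv.2 with h2 | h2
      · exact absurd (((le_dim_iff B _).mpr fun i hi => hne i hi (Or.inr h2)).trans hn) hnA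
      · have hvB : v.1 ≤ dim B :=
          (le_dim_iff B _).mpr fun i hi => hne i (by omega) (Or.inl hi.ne)
        obtain rfl : n = dim B := by omega
        exact obj_dim B
  exact ⟨⟨⟨⟨B⟩, hB⟩, ⟨f⟩, hf, hr⟩⟩

/-! ### Subobjects and the vertices they omit -/

theorem image_le_iff {A : Theta} (F : Subobject A) (G : Subfunctor (yoneda.obj A)) :
    image F ≤ G ↔ F.arrow ∈ G.obj (Opposite.op (F : Theta)) := by
  constructor
  · intro h
    exact h _ ⟨𝟙 (F : Theta), (Category.id_comp F.arrow :)⟩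
  · rintro h C _ ⟨t, rfl⟩
    exact G.map (Quiver.Hom.op (show C.unop ⟶ (F : Theta) from t)) h

theorem image_mk {A B : Theta} (f : B ⟶ A) [Mono f] :
    image (Subobject.mk f) = Subfunctor.range (yoneda.map f) := by
  apply le_antisymm
  · rw [image_le_iff]
    exact ⟨(Subobject.underlyingIso f).hom, Subobject.underlyingIso_hom_comp_eq_mk f⟩
  · rintro C _ ⟨t, rfl⟩
    refine ⟨(show C.unop ⟶ B from t) ≫ (Subobject.underlyingIso f).inv, ?_⟩
    exact (Category.assoc _ _ _).trans (congrArg (fun g => (show C.unop ⟶ B from t) ≫ g)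
      (Subobject.underlyingIso_arrow f))

theorem le_iff_arrow_mem {A : Theta} (F G : Subobject A) :
    F ≤ G ↔ F.arrow ∈ (image G).obj (Opposite.op (F : Theta)) := by
  constructor
  · intro h
    exact ⟨F.ofLE G h, Subobject.ofLE_arrow h⟩
  · rintro ⟨t, ht⟩
    exact Subobject.le_of_comm t ht

theorem not_isConst_id {n : SimplexCategory} (hn : n.len ≠ 0) : ¬ IsConst (𝟙 n) := fun h => hn <| by
  have := (isConst_iff _).mp h 0 (Fin.last _)
  simpa using (congrArg Fin.val this).symm

theorem dim_le_deg_id (A : FinProd) : dim A ≤ deg (𝟙 A) :=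
  (le_deg_iff _ _).mpr fun _ hi => not_isConst_id (len_ne_zero hi)

theorem id_notMem_omitting {A : Theta} {v : Vertex A.seq} (hv : v.1 < dim A.seq) :
    𝟙 A ∉ (omitting A v).obj (Opposite.op A) := by
  rw [mem_omitting (represents_id A)]
  exact fun h => h (hv.le.trans (dim_le_deg_id _)) v.2 rfl

theorem ne_top_of_arrow_mem {A : Theta} {F : Subobject A} {v : Vertex A.seq}
    (hv : v.1 < dim A.seq) (h : F.arrow ∈ (omitting A v).obj (Opposite.op (F : Theta))) :
    F ≠ ⊤ := by
  rintro rfl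
  have := (omitting A v).map (inv (⊤ : Subobject A).arrow).op h
  refine id_notMem_omitting hv ?_
  rw [← IsIso.inv_hom_id (⊤ : Subobject A).arrow]
  exact this

/-- A monomorphism omitting no vertex is surjective in each component; componentwise sections then
split it, so it is an isomorphism. -/
theorem exists_arrow_mem_omitting {A : Theta} {F : Subobject A} (hF : F ≠ ⊤) :
    ∃ v : Vertex A.seq, v.1 < dim A.seq ∧
      F.arrow ∈ (omitting A v).obj (Opposite.op (F : Theta)) := by
  by_contra! H
  obtain ⟨f, hf⟩ := exists_represents F.arrow
  have hsec : ∀ i, ∃ g : A.seq.obj i ⟶ (F : Theta).seq.obj i, g ≫ f.hom i = 𝟙 _ := by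
    intro i
    by_cases hi : i < dim A.seq
    · have : Epi (f.hom i) := SimplexCategory.epi_iff_surjective.mpr fun p => by
        have := (mem_omitting hf).not.mp (H ⟨i, p⟩ hi)
        simp only [Omits, ne_eq, not_forall, not_not] at this
        exact this.2
      have := isSplitEpi_of_epi (f.hom i)
      exact ⟨section_ (f.hom i), IsSplitEpi.id _⟩
    · refine ⟨SimplexCategory.Hom.mk ⟨fun _ => 0, fun _ _ _ => le_rfl⟩, ?_⟩
      ext x : 3
      have hl := A.len_eq_zero (not_lt.mp hi)
      apply Fin.ext
      omega
  choose g hg using hsec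
  have hr : Represents (A := A) (B := F) ⟨g⟩ (Theta.ofSeq ⟨g⟩) := represents_ofSeq _
  have hid : Theta.ofSeq ⟨g⟩ ≫ F.arrow = 𝟙 A :=
    (hr.comp hf).eq_of_rel (represents_id A) (rel_of_agree fun k _ => hg k)
  have : IsSplitEpi F.arrow := IsSplitEpi.mk' ⟨_, hid⟩
  have : IsIso F.arrow := isIso_of_mono_of_isSplitEpi _
  exact hF (Subobject.eq_top_of_isIso_arrow F)

namespace OppositeFace

variable {A : Theta} {v : Vertex A.seq} (D : OppositeFace A v)

/-- The inclusion of the face opposite to `v`. -/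
def hom : D.obj ⟶ A := Theta.ofSeq D.seqHom

theorem represents_hom : Represents D.seqHom D.hom := represents_ofSeq _

instance : Mono D.hom := mono_ofSeq _ D.mono

theorem range_eq : Subfunctor.range (yoneda.map D.hom) = omitting A v := by
  apply le_antisymm
  · rintro C _ ⟨t, rfl⟩
    obtain ⟨g, hg⟩ := exists_represents (show C.unop ⟶ D.obj from t)
    exact ⟨g ≫ D.seqHom, hg.comp D.represents_hom, fun _ x hx =>
      (D.range_iff v.1 v.2).mp ⟨_, hx⟩ rfl⟩
  · rintro C s ⟨f, hf, h⟩
    have hne : ∀ i ≤ deg f, ∀ x, (⟨i, (f.hom i).toOrderHom x⟩ : Vertex A.seq) ≠ v := by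
      rintro i hi x e
      rw [← e] at h
      exact h hi x rfl
    have hlift : ∀ i, ∃ g : C.unop.seq.obj i ⟶ D.obj.seq.obj i,
        i ≤ deg f → g ≫ D.seqHom.hom i = f.hom i := by
      intro i
      by_cases hi : i ≤ deg f
      · choose y hy using fun x => (D.range_iff i _).mpr (hne i hi x)
        have := D.mono i
        have hmono : StrictMono (D.seqHom.hom i).toOrderHom :=
          (D.seqHom.hom i).toOrderHom.monotone.strictMono_of_injective
            (injective_of_mono (D.seqHom.hom i))
        refine ⟨SimplexCategory.Hom.mk ⟨y, fun a b hab => hmono.le_iff_le.mp ?_⟩, fun _ => ?_⟩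
        · rw [hy, hy]
          exact (f.hom i).toOrderHom.monotone hab
        · ext x : 3
          exact hy x
      -- Above the degree any map will do, since the congruence ignores those components.
      · exact ⟨SimplexCategory.Hom.mk ⟨fun _ => 0, fun _ _ _ => le_rfl⟩, fun h => absurd h hi⟩
    choose g hg using hlift
    have hr : Represents (A := C.unop) (B := D.obj) ⟨g⟩ (Theta.ofSeq ⟨g⟩) := represents_ofSeq _
    exact ⟨Theta.ofSeq ⟨g⟩, ((hf.eq_of_rel (hr.comp D.represents_hom)
      (rel_of_agree fun k hk => (hg k hk).symm))).symm⟩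

theorem le_deg_of_hasFace (hv : v.HasFace) {i : ℕ} (hi : i < dim A.seq) :
    i ≤ deg D.seqHom := by
  refine (le_deg_iff _ _).mpr fun j hj hc => ?_
  have hor : j ≠ v.1 ∨ 2 ≤ (A.seq.obj v.1).len := by
    rcases hv.2 with h | h
    · exact Or.inr h
    · left; omega
  obtain ⟨p, q, hpq, hp, hq⟩ := v.exists_pair_ne (len_ne_zero (hj.trans hi)) hor
  obtain ⟨x, rfl⟩ := (D.range_iff j p).mpr hp
  obtain ⟨y, rfl⟩ := (D.range_iff j q).mpr hq
  exact hpq ((isConst_iff _).mp hc x y)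

/-- The face opposite to `v` as a subobject. -/
def subobject : Subobject A := Subobject.mk D.hom

theorem image_subobject : image D.subobject = omitting A v := by
  rw [subobject, image_mk, D.range_eq]

theorem le_subobject_iff (F : Subobject A) :
    F ≤ D.subobject ↔ F.arrow ∈ (omitting A v).obj (Opposite.op (F : Theta)) := by
  rw [le_iff_arrow_mem, D.image_subobject]

theorem arrow_mem : D.subobject.arrow ∈
    (omitting A v).obj (Opposite.op (D.subobject : Theta)) :=
  (D.le_subobject_iff _).mp le_rfl

/-- The face hits every vertex other than `v`, and `HasFace` keeps its degree large enough that no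
omission is vacuous. -/
theorem eq_of_arrow_mem (hv : v.HasFace) {w : Vertex A.seq} (hw : w.1 < dim A.seq)
    (h : D.subobject.arrow ∈ (omitting A w).obj (Opposite.op (D.subobject : Theta))) :
    w = v := by
  have h' : D.hom ∈ (omitting A w).obj (Opposite.op D.obj) := by
    have := (omitting A w).map (Subobject.underlyingIso D.hom).inv.op h
    rw [← Subobject.underlyingIso_arrow D.hom]
    exact this
  rw [mem_omitting D.represents_hom] at h'
  by_contra hne
  obtain ⟨x, hx⟩ := (D.range_iff w.1 w.2).mpr hne
  exact h' (D.le_deg_of_hasFace hv hw) x hx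

/-- A proper subobject above the face omits some vertex; the face omits it too, so it is `v`, and
the subobject is contained in the face. -/
theorem isFace (hv : v.HasFace) : IsFace D.subobject := by
  refine ⟨ne_top_of_arrow_mem hv.1 D.arrow_mem, fun G hG => ?_⟩
  by_contra hne
  obtain ⟨w, hw, hGw⟩ := exists_arrow_mem_omitting hne
  have hle : image D.subobject ≤ omitting A w := by
    rw [image_le_iff]
    have := (omitting A w).map (D.subobject.ofLE G hG.le).op hGw
    rw [← Subobject.ofLE_arrow hG.le]
    exact this
  obtain rfl := D.eq_of_arrow_mem hv hw ((image_le_iff _ _).mp hle)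
  exact hG.not_ge ((D.le_subobject_iff G).mpr hGw)

theorem eq_subobject {F : Subobject A} (hF : IsFace F) (hv : v.HasFace)
    (h : F.arrow ∈ (omitting A v).obj (Opposite.op (F : Theta))) : F = D.subobject :=
  ((hF.le_iff.mp ((D.le_subobject_iff F).mpr h)).resolve_left (D.isFace hv).1).symm

end OppositeFace

/-! ### Inner faces, horns and outer faces in terms of vertices -/

/-- A vertex which is neither the first nor the last one of its (nontrivial) component. -/
def Vertex.IsInner {A : FinProd} (v : Vertex A) : Prop :=
  v.1 < dim A ∧ v.2 ≠ 0 ∧ v.2 ≠ Fin.last _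

theorem two_le_of_ne {n : ℕ} {p : Fin (n + 1)} (h : p ≠ 0) (h' : p ≠ Fin.last _) : 2 ≤ n := by
  have h1 : (p : ℕ) ≠ 0 := fun e => h (Fin.ext e)
  have h2 : (p : ℕ) ≠ n := fun e => h' (Fin.ext e)
  omega

theorem Vertex.IsInner.hasFace {A : FinProd} {v : Vertex A} (hv : v.IsInner) : v.HasFace :=
  ⟨hv.1, Or.inl (two_le_of_ne hv.2.1 hv.2.2)⟩

theorem isInnerFace_of_isInner {A : Theta} {v : Vertex A.seq} (D : OppositeFace A v)
    (hv : v.IsInner) : IsInnerFace D.subobject := by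
  refine ⟨D.isFace hv.hasFace, ?_⟩
  obtain ⟨e, he⟩ := exists_represents (Subobject.underlyingIso D.hom).hom
  obtain ⟨e', he'⟩ := exists_represents (Subobject.underlyingIso D.hom).inv
  have hf : Represents (e ≫ D.seqHom) D.subobject.arrow := by
    have := he.comp D.represents_hom
    rwa [Subobject.underlyingIso_hom_comp_eq_mk] at this
  have hdeg : v.1 ≤ deg (e ≫ D.seqHom) := by
    obtain ⟨p, -, -, hp, -⟩ := v.exists_pair_ne (len_ne_zero hv.1)
      (Or.inr (two_le_of_ne hv.2.1 hv.2.2))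
    -- Below degree `v.1` the face would vacuously omit the further vertex `p` as well.
    have h := mt (D.eq_of_arrow_mem hv.hasFace (w := ⟨v.1, p⟩) hv.1) hp
    replace h := mt (mem_omitting hf).mpr h
    by_contra hlt
    exact h fun hle => absurd hle hlt
  refine ⟨_, hf, v.1, hv.1, hdeg, ?_, v.2, hv.2.1, hv.2.2, ?_⟩
  -- An isomorphism in `Theta` is invertible in its components only up to the degree, hence the
  -- bound `hk`.
  · have hid : rel (e ≫ e') (𝟙 _) := by
      refine (he.comp he').rel ?_
      rw [Iso.hom_inv_id]
      exact represents_id _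
    have hk : v.1 ≤ deg (e ≫ e') := by
      rw [hid.1]
      refine (hdeg.trans_eq ?_).trans (deg_comp_le_left (𝟙 _) (e ≫ D.seqHom))
      rw [Category.id_comp]
    have hm : e.hom v.1 ≫ e'.hom v.1 = 𝟙 _ := hid.2 _ hk
    have : Mono (e.hom v.1 ≫ e'.hom v.1) := by rw [hm]; infer_instance
    have := mono_of_mono (e.hom v.1) (e'.hom v.1)
    have := D.mono v.1
    exact mono_comp (e.hom v.1) (D.seqHom.hom v.1)
  · ext p
    constructor
    · rintro ⟨x, hx⟩ rfl
      exact (mem_omitting hf).mp D.arrow_mem hdeg x hx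
    · intro hp
      have h := mt (D.eq_of_arrow_mem hv.hasFace (w := ⟨v.1, p⟩) hv.1) fun h => hp (by
        obtain ⟨i, q⟩ := v
        simpa using h)
      replace h := mt (mem_omitting hf).mpr h
      simp only [Omits, ne_eq, not_forall, not_not] at h
      exact h.2

theorem isInner_of_isInnerFace {A : Theta} {v : Vertex A.seq} (D : OppositeFace A v)
    (hv : v.HasFace) (h : IsInnerFace D.subobject) : v.IsInner := by
  obtain ⟨-, f, hf, k, hk, -, -, i, hi0, hil, hr⟩ := h
  obtain rfl := D.eq_of_arrow_mem hv (w := ⟨k, i⟩) hk <| (mem_omitting hf).mpr fun _ x hx => by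
    have : i ∈ Set.range (f.hom k).toOrderHom := ⟨x, hx⟩
    rw [hr] at this
    exact this rfl
  exact ⟨hk, hi0, hil⟩

/-- A simplex which omits a vertex `v` lies in a face opposite to `v` or to an initial vertex. -/
theorem exists_hasFace_mem_omitting {A B : Theta} {v : Vertex A.seq} (hv : v.1 < dim A.seq)
    {s : B ⟶ A} (hs : s ∈ (omitting A v).obj (Opposite.op B)) :
    ∃ w : Vertex A.seq, w.HasFace ∧ s ∈ (omitting A w).obj (Opposite.op B) ∧
      (w = v ∨ w.2 = 0) := by
  by_cases h : v.HasFace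
  · exact ⟨v, h, hs, Or.inl rfl⟩
  · have hlen : (A.seq.obj v.1).len < 2 := by
      by_contra h2
      exact h ⟨hv, Or.inl (not_lt.mp h2)⟩
    have hne : v.1 + 1 ≠ dim A.seq := fun h2 => h ⟨hv, Or.inr h2⟩
    obtain ⟨f, hf⟩ := exists_represents s
    refine ⟨⟨dim A.seq - 1, 0⟩, ⟨by simp only; omega, Or.inr (by simp only; omega)⟩, ?_,
      Or.inr rfl⟩
    rw [mem_omitting hf] at hs ⊢
    intro hd
    simp only at hd
    -- Omitting one of at most two vertices forces a constant component, so the degree stays below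
    -- `dim A.seq - 1` and the vertex chosen there is omitted vacuously.
    have hc : IsConst (f.hom v.1) := (isConst_iff _).mpr fun x y => by
      have hx : ¬ ((f.hom v.1).toOrderHom x : ℕ) = v.2 := fun e =>
        hs (by omega) x (Fin.ext e)
      have hy : ¬ ((f.hom v.1).toOrderHom y : ℕ) = v.2 := fun e =>
        hs (by omega) y (Fin.ext e)
      apply Fin.ext
      omega
    have := deg_le f hc
    omega

theorem horn_eq_hornOf {A : Theta} {v : Vertex A.seq} (D : OppositeFace A v) (hv : v.IsInner) :
    horn D.subobject = hornOf A {v} := by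
  apply le_antisymm
  · refine iSup₂_le fun F hF => ?_
    obtain ⟨w, hw, h⟩ := exists_arrow_mem_omitting hF.1.1
    rw [image_le_iff, mem_hornOf]
    refine ⟨w, ⟨hw, fun hwv => hF.2 ?_⟩, h⟩
    obtain rfl := Finset.mem_singleton.mp hwv
    exact D.eq_subobject hF.1 hv.hasFace h
  · rintro ⟨B⟩ s hs
    obtain ⟨u, ⟨hu, huv⟩, h⟩ := mem_hornOf.mp hs
    obtain ⟨w, hw, h, hor⟩ := exists_hasFace_mem_omitting hu h
    -- The replacement vertex is initial whereas `v` is inner, so the missing face is never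
    -- reintroduced.
    have hwv : w ≠ v := by
      rintro rfl
      rcases hor with rfl | h0
      · exact huv (Finset.mem_singleton_self _)
      · exact hv.2.1 h0
    obtain ⟨E⟩ := hw.nonempty_oppositeFace
    have hE : E.subobject ≠ D.subobject := fun e =>
      hwv.symm (E.eq_of_arrow_mem hw hv.1 (e ▸ D.arrow_mem))
    rw [← E.image_subobject] at h
    exact le_iSup₂_of_le (f := fun (F : Subobject A) (_ : IsFace F ∧ F ≠ D.subobject) => image F)
      E.subobject ⟨E.isFace hw, hE⟩ le_rfl _ h

/-- The finite set of inner vertices. -/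
def innerVertices (A : FinProd) : Finset (Vertex A) :=
  (Finset.range (dim A)).sigma fun _ => Finset.univ.filter fun p => p ≠ 0 ∧ p ≠ Fin.last _

theorem mem_innerVertices {A : FinProd} {v : Vertex A} : v ∈ innerVertices A ↔ v.IsInner := by
  simp [innerVertices, Vertex.IsInner]

theorem outerFaces_eq_hornOf (A : Theta) : outerFaces A = hornOf A (innerVertices A.seq) := by
  apply le_antisymm
  · refine iSup₂_le fun F hF => ?_
    obtain ⟨w, hw, h⟩ := exists_arrow_mem_omitting hF.1.1
    rw [image_le_iff, mem_hornOf]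
    refine ⟨w, ⟨hw, fun hwi => hF.2 ?_⟩, h⟩
    rw [mem_innerVertices] at hwi
    obtain ⟨D⟩ := hwi.hasFace.nonempty_oppositeFace
    rw [D.eq_subobject hF.1 hwi.hasFace h]
    exact isInnerFace_of_isInner D hwi
  · rintro ⟨B⟩ s hs
    obtain ⟨u, ⟨hu, hui⟩, h⟩ := mem_hornOf.mp hs
    obtain ⟨w, hw, h, hor⟩ := exists_hasFace_mem_omitting hu h
    obtain ⟨E⟩ := hw.nonempty_oppositeFace
    have hE : ¬ IsInnerFace E.subobject := fun hE => by
      have hwi := isInner_of_isInnerFace E hw hE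
      rcases hor with rfl | h0
      · exact hui (mem_innerVertices.mpr hwi)
      · exact hwi.2.1 h0
    rw [← E.image_subobject] at h
    exact le_iSup₂_of_le (f := fun (F : Subobject A) (_ : IsOuterFace F) => image F)
      E.subobject ⟨E.isFace hw, hE⟩ le_rfl _ h

/-! ### Restricting generalized horns to a face -/

namespace OppositeFace

variable {A : Theta} {v : Vertex A.seq} (D : OppositeFace A v)

/-- The inclusion of the vertices of a face. -/
def vertexMap : Vertex D.obj.seq ↪ Vertex A.seq :=
  (Function.Embedding.refl ℕ).sigmaMap fun i =>
    ⟨(D.seqHom.hom i).toOrderHom, have := D.mono i; injective_of_mono (D.seqHom.hom i)⟩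

theorem exists_vertexMap_eq {w : Vertex A.seq} (hw : w ≠ v) : ∃ u, D.vertexMap u = w := by
  obtain ⟨x, hx⟩ := (D.range_iff w.1 w.2).mpr hw
  exact ⟨⟨w.1, x⟩, Sigma.ext rfl (heq_of_eq hx)⟩

theorem vertexMap_ne (u : Vertex D.obj.seq) : D.vertexMap u ≠ v :=
  (D.range_iff u.1 _).mp ⟨u.2, rfl⟩

theorem comp_mem_omitting {B : Theta} (t : B ⟶ D.obj) (u : Vertex D.obj.seq) :
    t ≫ D.hom ∈ (omitting A (D.vertexMap u)).obj (Opposite.op B) ↔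
      t ∈ (omitting D.obj u).obj (Opposite.op B) := by
  obtain ⟨f, hf⟩ := exists_represents t
  rw [mem_omitting hf, mem_omitting (hf.comp D.represents_hom)]
  unfold Omits
  rw [deg_comp_of_mono _ _ D.mono]
  have := D.mono u.1
  exact forall_congr' fun _ => forall_congr' fun x => not_congr
    (injective_of_mono (D.seqHom.hom u.1)).eq_iff

theorem dim_obj (hv : v.IsInner) : dim D.obj.seq = dim A.seq := by
  apply le_antisymm
  · refine (le_dim_iff _ _).mpr fun i hi => ?_
    have := D.mono i
    have h1 := SimplexCategory.len_le_of_mono (D.seqHom.hom i)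
    have h2 := len_ne_zero hi
    omega
  · refine (le_dim_iff _ _).mpr fun i hi => ?_
    obtain ⟨p, q, hpq, hp, hq⟩ := v.exists_pair_ne (len_ne_zero hi)
      (Or.inr (two_le_of_ne hv.2.1 hv.2.2))
    exact len_ne_zero_of_exists_ne _ ((D.range_iff i p).mpr hp) ((D.range_iff i q).mpr hq) hpq

/-- Since `v` is inner, the face contains both end vertices of every component, so its own end
vertices map to end vertices. -/
theorem isInner_of_vertexMap (hv : v.IsInner) {u : Vertex D.obj.seq}
    (hu : (D.vertexMap u).IsInner) : u.IsInner := by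
  obtain ⟨i, p⟩ := u
  have hmono := (D.seqHom.hom i).toOrderHom.monotone
  refine ⟨(D.dim_obj hv).symm ▸ hu.1, ?_, ?_⟩
  · intro (h : p = 0)
    subst h
    obtain ⟨x, hx⟩ := (D.range_iff i 0).mpr fun h => by
      subst h; exact hv.2.1 rfl
    exact hu.2.1 (le_antisymm (hx ▸ hmono (Fin.zero_le x)) (Fin.zero_le _))
  · intro (h : p = Fin.last _)
    subst h
    obtain ⟨x, hx⟩ := (D.range_iff i (Fin.last _)).mpr fun h => by
      subst h; exact hv.2.2 rfl
    exact hu.2.2 (le_antisymm (Fin.le_last _) (hx ▸ hmono (Fin.le_last x)))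

/-- The trace of a horn on a missing inner face is a horn of this face. -/
theorem preimage_hornOf (hv : v.IsInner) {S : Finset (Vertex A.seq)} (hS : v ∈ S) :
    (hornOf A S).preimage (yoneda.map D.hom) =
      hornOf D.obj (S.preimage D.vertexMap D.vertexMap.injective.injOn) := by
  apply le_antisymm
  · rintro ⟨B⟩ t ht
    obtain ⟨w, ⟨hw, hwS⟩, h⟩ := mem_hornOf.mp ht
    obtain ⟨u, rfl⟩ := D.exists_vertexMap_eq (w := w) fun h => hwS (h ▸ hS)
    refine mem_hornOf.mpr ⟨u, ⟨(D.dim_obj hv).symm ▸ hw, by simpa using hwS⟩, ?_⟩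
    exact (D.comp_mem_omitting t u).mp h
  · rintro ⟨B⟩ t ht
    obtain ⟨u, ⟨hu, huS⟩, h⟩ := mem_hornOf.mp ht
    refine mem_hornOf.mpr ⟨D.vertexMap u, ⟨?_, by simpa using huS⟩,
      (D.comp_mem_omitting t u).mpr h⟩
    rw [D.dim_obj hv] at hu
    exact hu

theorem hom_app_injective (U : Thetaᵒᵖ) : Function.Injective ((yoneda.map D.hom).app U) :=
  fun _ _ h => (cancel_mono D.hom).mp h

end OppositeFace

/-! ### Filling generalized horns, and the spine -/

/-- Generalized inner horn inclusions are inner anodyne. -/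
theorem innerAnodyne_hornOf {n : ℕ} : ∀ {A : Theta} {S : Finset (Vertex A.seq)},
    S.card = n + 1 → (∀ v ∈ S, v.IsInner) → innerAnodyne (hornOf A S).ι := by
  classical
  induction n with
  | zero =>
    intro A S hS hin
    obtain ⟨v, rfl⟩ := Finset.card_eq_one.mp hS
    have hv := hin v (Finset.mem_singleton_self v)
    obtain ⟨D⟩ := hv.hasFace.nonempty_oppositeFace
    rw [← horn_eq_hornOf D hv]
    exact MorphismProperty.le_llp_rlp _ _ ⟨_, isInnerFace_of_isInner D hv⟩
  | succ n ih =>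
    intro A S hS hin
    obtain ⟨v, hvS⟩ : S.Nonempty := Finset.card_pos.mp (by omega)
    have hv := hin v hvS
    obtain ⟨D⟩ := hv.hasFace.nonempty_oppositeFace
    have hle : hornOf A S ≤ hornOf A (S.erase v) := by
      rintro ⟨B⟩ s hs
      obtain ⟨w, ⟨hw, hwS⟩, h⟩ := mem_hornOf.mp hs
      exact mem_hornOf.mpr ⟨w, ⟨hw, fun h => hwS (Finset.mem_of_mem_erase h)⟩, h⟩
    have hr : Subfunctor.range (yoneda.map D.hom) ≤ hornOf A (S.erase v) := by
      rw [D.range_eq]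
      rintro ⟨B⟩ s hs
      exact mem_hornOf.mpr ⟨v, ⟨hv.1, Finset.notMem_erase v S⟩, hs⟩
    have hsup : hornOf A (S.erase v) ≤ hornOf A S ⊔ Subfunctor.range (yoneda.map D.hom) := by
      rw [D.range_eq]
      rintro ⟨B⟩ s hs
      obtain ⟨w, ⟨hw, hwS⟩, h⟩ := mem_hornOf.mp hs
      by_cases hwv : w = v
      · subst hwv
        exact Or.inr h
      · exact Or.inl (mem_hornOf.mpr
          ⟨w, ⟨hw, fun h => hwS (Finset.mem_erase.mpr ⟨hwv, h⟩)⟩, h⟩)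
    have hcard : (S.preimage D.vertexMap D.vertexMap.injective.injOn).card = n + 1 := by
      have : (S.preimage D.vertexMap D.vertexMap.injective.injOn).map D.vertexMap =
          S.erase v := by
        ext w
        simp only [Finset.mem_map, Finset.mem_preimage, Finset.mem_erase]
        constructor
        · rintro ⟨u, hu, rfl⟩
          exact ⟨D.vertexMap_ne u, hu⟩
        · rintro ⟨hwv, hw⟩
          obtain ⟨u, rfl⟩ := D.exists_vertexMap_eq hwv
          exact ⟨u, hw, rfl⟩
      rw [← Finset.card_map D.vertexMap, this, Finset.card_erase_of_mem hvS]
      omega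
    have htop := ih hcard fun u hu =>
      D.isInner_of_vertexMap hv (hin _ (Finset.mem_preimage.mp hu))
    rw [← D.preimage_hornOf hv hvS] at htop
    -- Attach the face opposite to `v` along its own generalized horn; `hrest` then fills the other
    -- missing faces.
    have hstep : innerAnodyne (Subfunctor.homOfLe hle) :=
      MorphismProperty.of_isPushout (P := innerFibrations.llp)
        (Subfunctor.isPushout_preimage _ D.hom_app_injective hle hr hsup).flip htop
    have hrest := ih (A := A) (S := S.erase v)
      (by rw [Finset.card_erase_of_mem hvS]; omega) fun u hu => hin u (Finset.mem_of_mem_erase hu)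
    rw [← Subfunctor.homOfLe_ι hle]
    exact MorphismProperty.comp_mem innerFibrations.llp _ _ hstep hrest

theorem spine_le_outerFaces {A : Theta} {k : ℕ} (hk : k < dim A.seq)
    (h2 : 2 ≤ (A.seq.obj k).len) : spine A ≤ outerFaces A := by
  rw [outerFaces_eq_hornOf]
  rintro ⟨B⟩ s ⟨f, hf, hs⟩
  by_cases h0 : Omits f ⟨k, 0⟩
  · exact mem_hornOf.mpr ⟨⟨k, 0⟩, ⟨hk, fun h => (mem_innerVertices.mp h).2.1 rfl⟩,
      (mem_omitting hf).mpr h0⟩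
  · refine mem_hornOf.mpr ⟨⟨k, Fin.last _⟩,
      ⟨hk, fun h => (mem_innerVertices.mp h).2.2 rfl⟩, (mem_omitting hf).mpr fun hd y hy => ?_⟩
    simp only [Omits, ne_eq, not_forall, not_not] at h0
    obtain ⟨-, x, hx⟩ := h0
    obtain ⟨i, hi⟩ := hs k hd
    have hix := hi x
    have hiy := hi y
    rw [hx] at hix
    rw [hy] at hiy
    simp only [Fin.val_zero, Fin.val_last] at hix hiy
    -- An edge `{i, i + 1}` containing both `0` and the last vertex contradicts length at least 2.
    omega

theorem spine_eq_top {A : Theta} (h : ∀ k < dim A.seq, (A.seq.obj k).len < 2) :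
    spine A = ⊤ := by
  refine top_le_iff.mp ?_
  rintro ⟨B⟩ s -
  obtain ⟨f, hf⟩ := exists_represents (A := B) (B := A) s
  refine ⟨f, hf, fun k _ => ⟨0, fun x => ?_⟩⟩
  have hlen : (A.seq.obj k).len < 2 := by
    by_cases hk : k < dim A.seq
    · exact h k hk
    · rw [A.len_eq_zero (not_lt.mp hk)]; omega
  omega

theorem innerAnodyne_outerFaces {A : Theta} {k : ℕ} (hk : k < dim A.seq)
    (h2 : 2 ≤ (A.seq.obj k).len) : innerAnodyne (outerFaces A).ι := by
  rw [outerFaces_eq_hornOf]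
  have hne : (innerVertices A.seq).Nonempty := by
    -- Vertex 1 is inner because the length is at least 2; without an inner vertex there would be no
    -- horn to fill.
    refine ⟨⟨k, ⟨1, by omega⟩⟩, mem_innerVertices.mpr ⟨hk, fun h => ?_, fun h => ?_⟩⟩
    · simpa using congrArg Fin.val h
    · have := congrArg Fin.val h
      simp only [Fin.val_last] at this
      omega
  exact innerAnodyne_hornOf (Nat.succ_pred_eq_of_pos hne.card_pos).symm
    fun v hv => mem_innerVertices.mp hv

end GenSimplex

end

theorem mainTheorem4
    (conj : ∀ A : GenSimplex.Theta, GenSimplex.innerAnodyne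
      (Subfunctor.homOfLe
        (le_sup_left : GenSimplex.spine A ≤ GenSimplex.spine A ⊔ GenSimplex.outerFaces A)))
    (A : GenSimplex.Theta) :
    GenSimplex.innerAnodyne (GenSimplex.spine A).ι := by
  by_cases h : ∃ k < GenSimplex.dim A.seq, 2 ≤ (A.seq.obj k).len
  · obtain ⟨k, hk, h2⟩ := h
    have hsup : GenSimplex.spine A ⊔ GenSimplex.outerFaces A = GenSimplex.outerFaces A :=
      sup_eq_right.mpr (GenSimplex.spine_le_outerFaces hk h2)
    have houter : GenSimplex.innerAnodyne (GenSimplex.spine A ⊔ GenSimplex.outerFaces A).ι := by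
      rw [hsup]
      exact GenSimplex.innerAnodyne_outerFaces hk h2
    rw [← Subfunctor.homOfLe_ι (le_sup_left :
      GenSimplex.spine A ≤ GenSimplex.spine A ⊔ GenSimplex.outerFaces A)]
    exact MorphismProperty.comp_mem GenSimplex.innerFibrations.llp _ _ (conj A) houter
  · push Not at h
    have := (Subfunctor.eq_top_iff_isIso _).mp (GenSimplex.spine_eq_top h)
    exact MorphismProperty.llp_of_isIso _ _
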